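/- Let $K,N_T,N_R\ge 1$ be integers, $\gamma_1,\dots,\gamma_K>0$ and $R>0$. For $k=1,\dots,K$ let $\mathbf H_k=\mathbf u_k\mathbf v_k^{\mathrm H}$ (the keyhole channel), where $\mathbf u_k\sim\mathcal{CN}(\mathbf 0,\mathbf I_{N_R})$ and $\mathbf v_k\sim\mathcal{CN}(\mathbf 0,\mathbf I_{N_T})$ are independent (every entry is a circularly symmetric complex normal variable with $\mathbb E|\cdot|^2=1$, and the entries are i.i.d.), and assume that $\mathbf H_1,\dots,\mathbf H_K$ are independent. The outage probability of Type-I HARQ after $K$ rounds at rate $R$ is $$P_{out}=\Pr\Big(\max_{1\le k\le K}\log_2\det\big(\mathbf I_{N_R}+\tfrac{\gamma_k}{N_T}\mathbf H_k\mathbf H_k^{\mathrm H}\big)<R\Big).$$ (i) For every $k$, the random variable $X_k=\|\mathbf u_k\|^2\|\mathbf v_k\|^2$ has on $(0,\infty)$ the probability density $$f(x)=\frac{2x^{(N_T+N_R)/2-1}K_\tau(2\sqrt x)}{\Gamma(N_T)\Gamma(N_R)},\qquad \tau=|N_T-N_R|,$$ where $K_\tau(z)=\frac12\left(\frac z2\right)^{\tau}\int_0^\infty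 e^{-t-z^2/(4t)}t^{-\tau-1}\,dt$ is the modified Bessel function of the second kind. (ii) The outage probability is $$P_{out}=\frac1{(\Gamma(N_T)\Gamma(N_R))^K}\prod_{k=1}^K G^{2,1}_{1,3}\!\left(\begin{matrix}1\\ N_T,N_R,0\end{matrix}\,\middle|\,\frac{N_T}{\gamma_k}(2^R-1)\right),$$ where, for $x>0$, $G^{2,1}_{1,3}$ is the Meijer G-function $$G^{2,1}_{1,3}\!\left(\begin{matrix}1\\ N_T,N_R,0\end{matrix}\,\middle|\,x\right)=\frac1{2\pi \mathrm i}\int_{c-\mathrm i\infty}^{c+\mathrm i\infty}\frac{\Gamma(N_T-s)\Gamma(N_R-s)\Gamma(s)}{\Gamma(1+s)}\,x^{s}\,ds$$ with $0<c<\min(N_T,N_R)$. Such $c$ exist, and for every such $c$ the integral converges absolutely, its value not depending on $c$. -/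

import Mathlib

open MeasureTheory ProbabilityTheory Set
open scoped Matrix NNReal ENNReal

noncomputable section

/-- The standard circularly symmetric complex normal law `CN(0, 1)` on `ℂ`: independent real and
imaginary parts, each centred normal with variance `1/2`. -/
def stdComplexNormal : Measure ℂ :=
  ((gaussianReal 0 (1 / 2 : ℝ≥0)).prod (gaussianReal 0 (1 / 2 : ℝ≥0))).map
    (fun p : ℝ × ℝ => (⟨p.1, p.2⟩ : ℂ))

/-- The law `CN(0, I_n)`: the coordinates are i.i.d. with law `CN(0, 1)`. -/
def stdComplexNormalVec (n : ℕ) : Measure (EuclideanSpace ℂ (Fin n)) :=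
  (Measure.pi (fun _ : Fin n => stdComplexNormal)).map (WithLp.toLp 2)

/-- The keyhole channel matrix `u vᴴ`, with entries `u i * conj (v j)`. -/
def keyholeChannel {NR NT : ℕ} (u : EuclideanSpace ℂ (Fin NR)) (v : EuclideanSpace ℂ (Fin NT)) :
    Matrix (Fin NR) (Fin NT) ℂ :=
  Matrix.of fun i j => u i * star (v j)

/-- The mutual information `log₂ det (I + (γ / N_T) H Hᴴ)` of one round. The determinant of this
Hermitian matrix is real, and is read off as a real part. -/
def roundMutualInfo {NR NT : ℕ} (γ : ℝ) (H : Matrix (Fin NR) (Fin NT) ℂ) : ℝ :=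
  Real.logb 2 (1 + ((γ / NT : ℝ) : ℂ) • (H * Hᴴ)).det.re

/-- The mutual information accumulated by Type-I HARQ over `K ≥ 1` rounds: the maximum over the
rounds. -/
def typeIMutualInfo {K NR NT : ℕ} [NeZero K] (γ : Fin K → ℝ)
    (H : Fin K → Matrix (Fin NR) (Fin NT) ℂ) : ℝ :=
  Finset.univ.sup' Finset.univ_nonempty (fun k => roundMutualInfo (γ k) (H k))

/-- The Type-I HARQ outage probability at rate `R`, for random channel matrices `H k`. -/
def typeIOutage {Ω : Type*} [MeasurableSpace Ω] (μ : Measure Ω) {K NR NT : ℕ} [NeZero K]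
    (γ : Fin K → ℝ) (H : Fin K → Ω → Matrix (Fin NR) (Fin NT) ℂ) (R : ℝ) : ℝ :=
  μ.real {ω | typeIMutualInfo γ (fun k => H k ω) < R}

/-- The modified Bessel function of the second kind,
`K_ν(x) = (1/2) (x/2)^ν ∫₀^∞ exp(-t - x²/(4t)) t^(-ν-1) dt` for `x > 0`. -/
def besselK (ν x : ℝ) : ℝ :=
  1 / 2 * (x / 2) ^ ν * ∫ t in Ioi (0 : ℝ), Real.exp (-t - x ^ 2 / (4 * t)) * t ^ (-ν - 1)

/-- The density of `‖u‖² ‖v‖²` on `(0, ∞)`: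
`2 x^((N_T+N_R)/2-1) K_{|N_T-N_R|}(2 √x) / (Γ(N_T) Γ(N_R))`. -/
def keyholeGainDensity (NT NR : ℕ) (x : ℝ) : ℝ :=
  2 * x ^ (((NT : ℝ) + NR) / 2 - 1) * besselK |(NT : ℝ) - NR| (2 * √x) /
    (Real.Gamma NT * Real.Gamma NR)

/-- The integrand of the Mellin-Barnes integral of `G^{m,n}_{p,q}(a; b | z)`. Indices are counted
from `0`, so the first `m` of the `b j` are those with `j.val < m`. -/
def meijerGIntegrand (m n : ℕ) {p q : ℕ} (a : Fin p → ℂ) (b : Fin q → ℂ) (z s : ℂ) : ℂ :=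
  ((∏ j : Fin q with j.val < m, Complex.Gamma (b j - s)) *
      ∏ j : Fin p with j.val < n, Complex.Gamma (1 - a j + s)) /
    ((∏ j : Fin q with m ≤ j.val, Complex.Gamma (1 - b j + s)) *
      ∏ j : Fin p with n ≤ j.val, Complex.Gamma (a j - s)) * z ^ s

/-- The vertical line `Re s = c` separates the poles of the `Γ(b j - s)`, `j.val < m`, on its
right, from those of the `Γ(1 - a j + s)`, `j.val < n`, on its left. -/
def SeparatesPoles (m n : ℕ) {p q : ℕ} (a : Fin p → ℂ) (b : Fin q → ℂ) (c : ℝ) : Prop :=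
  (∀ j : Fin q, j.val < m → c < (b j).re) ∧ (∀ j : Fin p, j.val < n → (a j).re - 1 < c)

/-- The Mellin-Barnes integral `(1 / (2 π i)) ∫` along the line from `c - i∞` to `c + i∞`, where
`s = c + i t` and `ds = i dt`. -/
def meijerGLine (m n : ℕ) {p q : ℕ} (a : Fin p → ℂ) (b : Fin q → ℂ) (c : ℝ) (z : ℂ) : ℂ :=
  1 / (2 * Real.pi) * ∫ t : ℝ, meijerGIntegrand m n a b z (c + t * Complex.I)

open Classical in
/-- The Meijer G-function `G^{m,n}_{p,q}(a; b | z)`, as the Mellin-Barnes integral along a vertical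
line that separates the two families of poles (for parameters that admit such a line). -/
def meijerG (m n : ℕ) {p q : ℕ} (a : Fin p → ℂ) (b : Fin q → ℂ) (z : ℂ) : ℂ :=
  if h : ∃ c : ℝ, SeparatesPoles m n a b c then meijerGLine m n a b h.choose z else 0

end

/-!
Write `m = N_T`, `n = N_R`. The norms `‖u‖²` and `‖v‖²` are independent gamma variables of rate one
and shapes `n` and `m`, because their characteristic functions are `(1 - it)⁻ⁿ` and `(1 - it)⁻ᵐ`
(`hasLaw_sq_norm_stdComplexNormalVec`). Multiplicative convolution of the two gamma densities is,
after the substitution `x = t y`, the integral that defines the Bessel function; this gives the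
density of `X = ‖u‖² ‖v‖²` (`map_mul_gammaMeasure_prod`).

For `0 < Re s < min(m, n)` one has `E X^(-s) = Γ(m - s) Γ(n - s) / (Γ(m) Γ(n))`, and exchanging
integrals, the distribution function `F` of `X` has Mellin transform `E X^(-s) / s` at `-s`
(`mellin_cdf`, `mellin_cdf_keyholeGainLaw`). As `Γ(s) / Γ(1 + s) = 1 / s`, this is the Mellin-Barnes
integrand divided by `Γ(m) Γ(n)`. It decays quadratically on vertical lines
(`norm_Gamma_mul_Gamma_div_le`), so Mellin inversion applies and yields
`G(x) = Γ(m) Γ(n) F(x)` for every separating line (`meijerGLine_eq_cdf`); the independence of the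
line follows.

Finally `H Hᴴ` has rank one, so the mutual information of a round is below `R` exactly when
`X < (N_T / γ) (2^R - 1)` (`roundMutualInfo_keyholeChannel_lt_iff`). Since `X` is the squared
Frobenius norm of `H`, the events of different rounds are independent, and the outage probability is
the product of the values of `F`.
-/

/-! ### Gamma laws and the norm of a complex normal vector -/

theorem gammaMeasure_one_eq_withDensity_Ioi (a : ℝ) :
    gammaMeasure a 1 = (volume.restrict (Ioi (0 : ℝ))).withDensity
      (fun x => ENNReal.ofReal (x ^ (a - 1) * Real.exp (-x) / Real.Gamma a)) := by
  rw [Measure.restrict_congr_set Ioi_ae_eq_Ici, ← withDensity_indicator measurableSet_Ici,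
    gammaMeasure]
  congr 1
  ext x
  by_cases hx : 0 ≤ x
  · rw [indicator_of_mem (mem_Ici.2 hx), gammaPDF_of_nonneg hx]
    congr 1
    rw [Real.one_rpow, one_mul]
    ring
  · rw [indicator_of_notMem (by simpa using hx), gammaPDF_of_neg (not_le.1 hx)]

theorem integral_gammaMeasure_one {a : ℝ} (ha : 0 < a) (f : ℝ → ℂ) :
    ∫ x, f x ∂gammaMeasure a 1 =
      (∫ x in Ioi (0 : ℝ), ((x : ℂ) ^ ((a : ℂ) - 1) * Complex.exp (-x)) * f x) /
        Complex.Gamma a := by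
  have hG : 0 < Real.Gamma a := Real.Gamma_pos_of_pos ha
  rw [gammaMeasure_one_eq_withDensity_Ioi, integral_withDensity_eq_integral_toReal_smul₀
    (by fun_prop) (by simp), ← integral_div]
  refine setIntegral_congr_fun measurableSet_Ioi fun x hx => ?_
  have hx : 0 < x := hx
  have : (0 : ℝ) ≤ x ^ (a - 1) * Real.exp (-x) / Real.Gamma a := by positivity
  simp only [ENNReal.toReal_ofReal this, Complex.real_smul]
  rw [Complex.Gamma_ofReal]
  push_cast [Complex.ofReal_cpow hx.le]
  ring

/-- The integrals `∫₀^∞ xⁿ e^{-bx} dx` for `b = 1 - it`, by the recursion that integration by parts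
gives. -/
theorem integral_pow_mul_cexp_neg_Ioi (t : ℝ) (n : ℕ) :
    ∫ x in Ioi (0 : ℝ), (x : ℂ) ^ n * Complex.exp (-(1 - t * Complex.I) * x) =
      n.factorial / (1 - t * Complex.I) ^ (n + 1) := by
  set b : ℂ := 1 - t * Complex.I with hb
  have hb0 : b ≠ 0 := fun h => by simpa [hb] using congrArg Complex.re h
  have hnorm : ∀ (m : ℕ) (x : ℝ), 0 ≤ x → ‖(x : ℂ) ^ m * Complex.exp (-b * x)‖ =
      x ^ m * Real.exp (-x) := by
    intro m x hx
    rw [norm_mul, norm_pow, Complex.norm_real, Real.norm_of_nonneg hx, Complex.norm_exp]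
    simp [hb]
  have hint : ∀ m : ℕ,
      IntegrableOn (fun x : ℝ => (x : ℂ) ^ m * Complex.exp (-b * x)) (Ioi 0) := by
    intro m
    have h := Real.GammaIntegral_convergent (s := m + 1) (by positivity)
    refine Integrable.mono' h (by fun_prop) ?_
    refine (ae_restrict_iff' measurableSet_Ioi).2 (ae_of_all _ fun x hx => ?_)
    rw [hnorm m x (le_of_lt hx), add_sub_cancel_right, Real.rpow_natCast, mul_comm]
  have hlim : ∀ m : ℕ, Filter.Tendsto (fun x : ℝ => (x : ℂ) ^ m * Complex.exp (-b * x))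
      Filter.atTop (nhds 0) := by
    intro m
    rw [tendsto_zero_iff_norm_tendsto_zero]
    refine (Real.tendsto_pow_mul_exp_neg_atTop_nhds_zero m).congr' ?_
    filter_upwards [Filter.eventually_ge_atTop 0] with x hx using (hnorm m x hx).symm
  have hexp : ∀ x : ℝ, HasDerivAt (fun x : ℝ => Complex.exp (-b * x))
      (Complex.exp (-b * x) * (-b)) x := fun x => by
    simpa using ((hasDerivAt_id x).ofReal_comp.const_mul (-b)).cexp
  induction n with
  | zero =>
    have h := integral_Ioi_of_hasDerivAt_of_tendsto' (a := 0) (fun x _ => hexp x)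
      (by have h := (hint 0).mul_const (-b); simp only [pow_zero, one_mul] at h; exact h)
      (by simpa using hlim 0)
    rw [integral_mul_const] at h
    simp only [pow_zero, one_mul, Nat.factorial_zero, Nat.cast_one, zero_add, pow_one]
    rw [eq_div_iff hb0]
    simp [-neg_mul] at h
    linear_combination h
  | succ n ih =>
    have hderiv : ∀ x : ℝ, HasDerivAt (fun x : ℝ => (x : ℂ) ^ (n + 1) * Complex.exp (-b * x))
        (((n + 1 : ℕ) : ℂ) * ((x : ℂ) ^ n * Complex.exp (-b * x)) +
          (-b) * ((x : ℂ) ^ (n + 1) * Complex.exp (-b * x))) x := fun x => by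
      have h := ((hasDerivAt_id x).ofReal_comp.pow (n + 1)).mul (hexp x)
      refine h.congr_deriv ?_
      simp
      ring
    have h := integral_Ioi_of_hasDerivAt_of_tendsto' (a := 0) (fun x _ => hderiv x)
      (((hint n).const_mul _).add ((hint (n + 1)).const_mul _)) (hlim (n + 1))
    rw [integral_add ((hint n).const_mul _) ((hint (n + 1)).const_mul _), integral_const_mul,
      integral_const_mul, ih] at h
    rw [eq_div_iff (pow_ne_zero _ hb0)]
    have h' : b * ∫ x in Ioi (0 : ℝ), (x : ℂ) ^ (n + 1) * Complex.exp (-b * x) =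
        ((n + 1 : ℕ) : ℂ) * (n.factorial / b ^ (n + 1)) := by
      simp [-neg_mul] at h
      push_cast
      linear_combination -h
    rw [pow_succ b (n + 1), mul_comm (b ^ (n + 1)) b, ← mul_assoc,
      mul_comm (∫ x in Ioi (0 : ℝ), (x : ℂ) ^ (n + 1) * Complex.exp (-b * x)) b, h',
      Nat.factorial_succ]
    field_simp
    push_cast
    ring

theorem charFun_gammaMeasure_natCast_one {n : ℕ} (hn : 1 ≤ n) (t : ℝ) :
    charFun (gammaMeasure n 1) t = (1 / (1 - t * Complex.I)) ^ n := by
  obtain ⟨m, rfl⟩ := Nat.exists_eq_add_of_le' hn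
  rw [charFun_apply_real, integral_gammaMeasure_one (by positivity)]
  have h : ∀ x : ℝ, ((x : ℂ) ^ ((((m + 1 : ℕ) : ℝ) : ℂ) - 1) * Complex.exp (-x)) *
      Complex.exp (t * x * Complex.I) =
        (x : ℂ) ^ m * Complex.exp (-(1 - t * Complex.I) * x) := by
    intro x
    have : ((((m + 1 : ℕ) : ℝ) : ℂ) - 1) = (m : ℂ) := by push_cast; ring
    rw [this, Complex.cpow_natCast, mul_assoc, ← Complex.exp_add]
    ring_nf
  simp_rw [h]
  rw [integral_pow_mul_cexp_neg_Ioi]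
  have : (((m + 1 : ℕ) : ℝ) : ℂ) = (m : ℂ) + 1 := by push_cast; ring
  rw [this, Complex.Gamma_nat_eq_factorial, div_right_comm,
    div_self (Nat.cast_ne_zero.2 (Nat.factorial_ne_zero m)), one_div_pow]

/-- Only the square is recorded: it avoids a choice of complex square root, and the real and
imaginary parts contribute one factor each. -/
theorem sq_integral_cexp_sq_gaussianReal_half (t : ℝ) :
    (∫ x, Complex.exp (t * x ^ 2 * Complex.I) ∂gaussianReal 0 (1 / 2 : ℝ≥0)) ^ 2 =
      1 / (1 - t * Complex.I) := by
  have hpi : (0 : ℝ) < Real.pi := Real.pi_pos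
  rw [integral_gaussianReal_eq_integral_smul (by norm_num)]
  have h : ∀ x : ℝ, gaussianPDFReal 0 (1 / 2 : ℝ≥0) x • Complex.exp (t * x ^ 2 * Complex.I) =
      ((√Real.pi)⁻¹ : ℝ) * Complex.exp (-(1 - t * Complex.I) * x ^ 2) := by
    intro x
    have h2 : gaussianPDFReal 0 (1 / 2 : ℝ≥0) x = (√Real.pi)⁻¹ * Real.exp (-x ^ 2) := by
      rw [gaussianPDFReal]
      norm_num
      field_simp
    rw [h2, Complex.real_smul]
    push_cast
    rw [mul_assoc, ← Complex.exp_add]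
    ring_nf
  simp_rw [h]
  rw [integral_const_mul, mul_pow, integral_gaussian_sq_complex (by simp), ← Complex.ofReal_pow,
    inv_pow, Real.sq_sqrt hpi.le, Complex.ofReal_inv]
  have : (Real.pi : ℂ) ≠ 0 := Complex.ofReal_ne_zero.2 hpi.ne'
  field_simp

theorem integral_cexp_sq_norm_stdComplexNormal (t : ℝ) :
    ∫ z, Complex.exp (t * (‖z‖ ^ 2 : ℝ) * Complex.I) ∂stdComplexNormal =
      1 / (1 - t * Complex.I) := by
  have hm : Measurable (fun p : ℝ × ℝ => (⟨p.1, p.2⟩ : ℂ)) :=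
    Complex.measurableEquivRealProd.symm.measurable
  rw [stdComplexNormal, integral_map hm.aemeasurable (by fun_prop)]
  have : ∀ p : ℝ × ℝ, Complex.exp (t * (‖(⟨p.1, p.2⟩ : ℂ)‖ ^ 2 : ℝ) * Complex.I) =
      Complex.exp (t * p.1 ^ 2 * Complex.I) * Complex.exp (t * p.2 ^ 2 * Complex.I) := by
    intro p
    rw [← Complex.exp_add, Complex.sq_norm, Complex.normSq_mk]
    push_cast
    ring_nf
  simp_rw [this]
  rw [integral_prod_mul (fun x : ℝ => Complex.exp (t * x ^ 2 * Complex.I))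
    (fun x : ℝ => Complex.exp (t * x ^ 2 * Complex.I)), ← sq,
    sq_integral_cexp_sq_gaussianReal_half]

instance isProbabilityMeasure_stdComplexNormal : IsProbabilityMeasure stdComplexNormal :=
  Measure.isProbabilityMeasure_map Complex.measurableEquivRealProd.symm.measurable.aemeasurable

/-- The characteristic functions agree: both are `(1 - it)⁻ⁿ`. -/
theorem hasLaw_sq_norm_stdComplexNormalVec {n : ℕ} (hn : 1 ≤ n) :
    HasLaw (fun z => ‖z‖ ^ 2) (gammaMeasure n 1) (stdComplexNormalVec n) where
  aemeasurable := by fun_prop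
  map_eq := by
    have hn' : (0 : ℝ) < n := by exact_mod_cast hn
    have := isProbabilityMeasure_gammaMeasure hn' one_pos
    have : IsProbabilityMeasure (stdComplexNormalVec n) :=
      Measure.isProbabilityMeasure_map (by fun_prop)
    refine Measure.ext_of_charFun (funext fun t => ?_)
    rw [charFun_gammaMeasure_natCast_one hn, charFun_apply_real,
      integral_map (by fun_prop) (by fun_prop), stdComplexNormalVec,
      integral_map (by fun_prop) (by fun_prop)]
    have : ∀ z : Fin n → ℂ, Complex.exp (t * (‖WithLp.toLp 2 z‖ ^ 2 : ℝ) * Complex.I) =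
        ∏ i, Complex.exp (t * (‖z i‖ ^ 2 : ℝ) * Complex.I) := by
      intro z
      rw [← Complex.exp_sum, EuclideanSpace.norm_sq_eq]
      push_cast
      rw [Finset.mul_sum, Finset.sum_mul]
    simp_rw [this]
    rw [integral_fintype_prod_eq_prod
      (f := fun (_ : Fin n) (z : ℂ) => Complex.exp (t * (‖z‖ ^ 2 : ℝ) * Complex.I))]
    simp_rw [integral_cexp_sq_norm_stdComplexNormal]
    simp

/-! ### The density of a product of gamma variables -/

theorem setLIntegral_Ioi_comp_mul_left {c : ℝ} (hc : 0 < c) {f : ℝ → ℝ≥0∞} (hf : Measurable f) :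
    ∫⁻ x in Ioi (0 : ℝ), f (c * x) = ENNReal.ofReal c⁻¹ * ∫⁻ x in Ioi (0 : ℝ), f x := by
  have hm : Measurable (fun x : ℝ => c * x) := measurable_const_mul c
  have h := lintegral_map (μ := volume) (hf.indicator (measurableSet_Ioi (a := (0 : ℝ)))) hm
  rw [Real.map_volume_mul_left hc.ne', lintegral_smul_measure,
    lintegral_indicator measurableSet_Ioi, abs_of_pos (inv_pos.2 hc)] at h
  rw [← smul_eq_mul, h, ← lintegral_indicator measurableSet_Ioi]
  refine lintegral_congr fun x => ?_
  by_cases hx : 0 < x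
  · rw [indicator_of_mem (mem_Ioi.2 hx), indicator_of_mem (mem_Ioi.2 (mul_pos hc hx))]
  · rw [indicator_of_notMem (by simpa using hx), indicator_of_notMem]
    simpa [mul_pos_iff_of_pos_left hc] using hx

/-- The multiplicative convolution of two gamma laws: the density of the product at `x` is the
integral over the value `t` of the first factor, the second one being `x / t`. -/
theorem map_mul_gammaMeasure_one_prod (a b : ℝ) (hb : 0 < b) :
    ((gammaMeasure a 1).prod (gammaMeasure b 1)).map (fun p => p.1 * p.2) =
      (volume.restrict (Ioi (0 : ℝ))).withDensity (fun x => ∫⁻ t in Ioi (0 : ℝ),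
        ENNReal.ofReal (x ^ (b - 1) * (Real.exp (-t - x / t) * t ^ (a - b - 1)) /
          (Real.Gamma b * Real.Gamma a))) := by
  have := isProbabilityMeasure_gammaMeasure hb one_pos
  ext s hs
  have hms : MeasurableSet ((fun p : ℝ × ℝ => p.1 * p.2) ⁻¹' s) := measurable_mul hs
  set g : ℝ → ℝ≥0∞ := fun x => ENNReal.ofReal (x ^ (b - 1) * Real.exp (-x) / Real.Gamma b) with hg
  have hgm : Measurable g := by fun_prop
  have hind : Measurable (s.indicator (1 : ℝ → ℝ≥0∞)) := measurable_one.indicator hs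
  have hinner : ∀ t ∈ Ioi (0 : ℝ),
      gammaMeasure b 1 (Prod.mk t ⁻¹' ((fun p : ℝ × ℝ => p.1 * p.2) ⁻¹' s)) =
        ENNReal.ofReal t⁻¹ * ∫⁻ x in Ioi (0 : ℝ), s.indicator 1 x * g (x / t) := by
    intro t ht
    have ht : 0 < t := ht
    rw [← setLIntegral_Ioi_comp_mul_left ht (by fun_prop),
      gammaMeasure_one_eq_withDensity_Ioi b, withDensity_apply _ (measurable_prodMk_left hms),
      ← lintegral_indicator (measurable_prodMk_left hms)]
    refine lintegral_congr fun y => ?_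
    rw [mul_div_cancel_left₀ _ ht.ne']
    by_cases hy : t * y ∈ s
    · rw [indicator_of_mem (by exact hy), indicator_of_mem hy, Pi.one_apply, one_mul]
    · rw [indicator_of_notMem (by exact hy), indicator_of_notMem hy, zero_mul]
  rw [Measure.map_apply measurable_mul hs, Measure.prod_apply hms, withDensity_apply _ hs,
    gammaMeasure_one_eq_withDensity_Ioi a,
    lintegral_withDensity_eq_lintegral_mul _ (by fun_prop) (measurable_measure_prodMk_left hms),
    ← lintegral_indicator hs]
  have hL : ∀ t ∈ Ioi (0 : ℝ), ((fun x : ℝ =>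
      ENNReal.ofReal (x ^ (a - 1) * Real.exp (-x) / Real.Gamma a)) * fun t =>
        gammaMeasure b 1 (Prod.mk t ⁻¹' ((fun p : ℝ × ℝ => p.1 * p.2) ⁻¹' s))) t =
      ∫⁻ x in Ioi (0 : ℝ), s.indicator 1 x *
        (ENNReal.ofReal (t ^ (a - 1) * Real.exp (-t) / Real.Gamma a) *
          ENNReal.ofReal t⁻¹ * g (x / t)) := by
    intro t ht
    rw [Pi.mul_apply, hinner t ht, ← mul_assoc, ← lintegral_const_mul _ (by fun_prop)]
    refine lintegral_congr fun x => ?_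
    ring
  rw [setLIntegral_congr_fun measurableSet_Ioi hL, lintegral_lintegral_swap
    ((hind.comp measurable_snd).mul (by fun_prop)).aemeasurable]
  refine setLIntegral_congr_fun measurableSet_Ioi fun x hx => ?_
  have hx : 0 < x := hx
  by_cases hxs : x ∈ s
  swap
  · simp [hxs]
  simp only [indicator_of_mem hxs, Pi.one_apply, one_mul]
  refine setLIntegral_congr_fun measurableSet_Ioi fun t ht => ?_
  have ht : 0 < t := ht
  have hGb : 0 < Real.Gamma b := Real.Gamma_pos_of_pos hb
  simp only [hg]
  rw [← ENNReal.ofReal_mul' (by positivity), ← ENNReal.ofReal_mul' (by positivity)]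
  congr 1
  rw [Real.div_rpow hx.le ht.le, Real.exp_sub, Real.exp_neg (x / t),
    show a - b - 1 = (a - 1) - 1 - (b - 1) by ring, Real.rpow_sub ht _ (b - 1),
    Real.rpow_sub ht (a - 1) 1, Real.rpow_one]
  field_simp

theorem keyholeGainDensity_comm (m n : ℕ) (x : ℝ) :
    keyholeGainDensity m n x = keyholeGainDensity n m x := by
  rw [keyholeGainDensity, keyholeGainDensity, abs_sub_comm, add_comm (m : ℝ),
    mul_comm (Real.Gamma m)]

/-- For `m ≤ n` the Bessel integral, with `ν = n - m` and argument `2 √x`, is the convolution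
integral itself. -/
theorem keyholeGainDensity_eq_of_le {m n : ℕ} (h : m ≤ n) {x : ℝ} (hx : 0 < x) :
    keyholeGainDensity n m x = ∫ t in Ioi (0 : ℝ),
      x ^ ((n : ℝ) - 1) * (Real.exp (-t - x / t) * t ^ ((m : ℝ) - n - 1)) /
        (Real.Gamma n * Real.Gamma m) := by
  have h0 : (0 : ℝ) ≤ (n : ℝ) - m := sub_nonneg.2 (by exact_mod_cast h)
  have hpow : x ^ ((n : ℝ) - 1) = x ^ (((n : ℝ) + m) / 2 - 1) * √x ^ ((n : ℝ) - m) := by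
    rw [Real.sqrt_eq_rpow, ← Real.rpow_mul hx.le, ← Real.rpow_add hx]
    ring_nf
  have hint : ∫ t in Ioi (0 : ℝ), Real.exp (-t - (2 * √x) ^ 2 / (4 * t)) *
      t ^ (-((n : ℝ) - m) - 1) =
      ∫ t in Ioi (0 : ℝ), Real.exp (-t - x / t) * t ^ ((m : ℝ) - n - 1) := by
    refine setIntegral_congr_fun measurableSet_Ioi fun t ht => ?_
    rw [neg_sub, mul_pow, Real.sq_sqrt hx.le, show (2 : ℝ) ^ 2 = 4 by norm_num,
      mul_div_mul_left _ _ four_ne_zero]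
  rw [integral_div, integral_const_mul, keyholeGainDensity, besselK, abs_of_nonneg h0, hint,
    mul_div_cancel_left₀ _ two_ne_zero, hpow]
  ring

theorem map_mul_gammaMeasure_prod_of_le {m n : ℕ} (hm : 1 ≤ m) (hmn : m ≤ n) :
    ((gammaMeasure m 1).prod (gammaMeasure n 1)).map (fun p => p.1 * p.2) =
      (volume.restrict (Ioi (0 : ℝ))).withDensity
        (fun x => ENNReal.ofReal (keyholeGainDensity n m x)) := by
  have hm0 : (0 : ℝ) < m := by exact_mod_cast hm
  have hn0 : (0 : ℝ) < n := by exact_mod_cast hm.trans hmn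
  have := isProbabilityMeasure_gammaMeasure hm0 one_pos
  have := isProbabilityMeasure_gammaMeasure hn0 one_pos
  have hprob : IsProbabilityMeasure (((gammaMeasure m 1).prod (gammaMeasure n 1)).map
      (fun p : ℝ × ℝ => p.1 * p.2)) := Measure.isProbabilityMeasure_map (by fun_prop)
  have hG : 0 < Real.Gamma n * Real.Gamma m :=
    mul_pos (Real.Gamma_pos_of_pos hn0) (Real.Gamma_pos_of_pos hm0)
  have hconv := map_mul_gammaMeasure_one_prod m n hn0
  -- the total mass is one, so the convolution integral is finite at almost every point
  have hfin := congrArg (fun ρ : Measure ℝ => ρ univ) hconv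
  simp only [measure_univ, withDensity_apply _ MeasurableSet.univ, Measure.restrict_univ] at hfin
  have hlt := ae_lt_top (Measurable.lintegral_prod_right' (ν := volume.restrict (Ioi (0 : ℝ)))
    (f := fun p : ℝ × ℝ => ENNReal.ofReal (p.1 ^ ((n : ℝ) - 1) *
      (Real.exp (-p.2 - p.1 / p.2) * p.2 ^ ((m : ℝ) - n - 1)) /
        (Real.Gamma n * Real.Gamma m))) (by fun_prop))
    (μ := volume.restrict (Ioi (0 : ℝ))) (by rw [← hfin]; exact ENNReal.one_ne_top)
  rw [hconv]
  refine withDensity_congr_ae ?_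
  filter_upwards [hlt, ae_restrict_mem measurableSet_Ioi] with x hxlt hx
  have hx : 0 < x := hx
  have hnonneg : ∀ᵐ t ∂volume.restrict (Ioi (0 : ℝ)), 0 ≤ x ^ ((n : ℝ) - 1) *
      (Real.exp (-t - x / t) * t ^ ((m : ℝ) - n - 1)) / (Real.Gamma n * Real.Gamma m) := by
    filter_upwards [ae_restrict_mem measurableSet_Ioi] with t ht
    have ht : 0 < t := ht
    positivity
  rw [keyholeGainDensity_eq_of_le hmn hx, ofReal_integral_eq_lintegral_ofReal _ hnonneg]
  exact (lintegral_ofReal_ne_top_iff_integrable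
    (by fun_prop) hnonneg).1 hxlt.ne

/-- The product of independent gamma variables with integer shapes `m` and `n` and unit rate has the
Bessel density. -/
theorem map_mul_gammaMeasure_prod {m n : ℕ} (hm : 1 ≤ m) (hn : 1 ≤ n) :
    ((gammaMeasure m 1).prod (gammaMeasure n 1)).map (fun p => p.1 * p.2) =
      (volume.restrict (Ioi (0 : ℝ))).withDensity
        (fun x => ENNReal.ofReal (keyholeGainDensity n m x)) := by
  rcases le_total m n with h | h
  · exact map_mul_gammaMeasure_prod_of_le hm h
  · have := isProbabilityMeasure_gammaMeasure (a := m) (by exact_mod_cast hm) one_pos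
    have := isProbabilityMeasure_gammaMeasure (a := n) (by exact_mod_cast hn) one_pos
    rw [← Measure.prod_swap, Measure.map_map (by fun_prop) measurable_swap]
    simp_rw [keyholeGainDensity_comm n m]
    rw [← map_mul_gammaMeasure_prod_of_le hn h]
    congr 1
    ext p
    exact mul_comm _ _

/-! ### Mellin transforms and vertical decay -/

/-- Swapping the integrals in `∫₀^∞ t^(s-1) P(X ≤ t) dt = E ∫_X^∞ t^(s-1) dt` gives the Mellin
transform of a distribution function from the moments. -/
theorem mellin_cdf {ρ : Measure ℝ} [IsProbabilityMeasure ρ] (hρ : ∀ᵐ x ∂ρ, 0 < x) {s : ℂ}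
    (hs : s.re < 0) (hint : Integrable (fun x : ℝ => (x : ℂ) ^ s) ρ) :
    MellinConvergent (fun t => (cdf ρ t : ℂ)) s ∧
      mellin (fun t => (cdf ρ t : ℂ)) s = -(∫ x, (x : ℂ) ^ s ∂ρ) / s := by
  set f : ℝ → ℝ → ℂ := fun t x => (t : ℂ) ^ (s - 1) * (Iic t).indicator 1 x with hf
  have hre : (s - 1).re < -1 := by
    rw [Complex.sub_re, Complex.one_re]
    linarith
  have hfx : ∀ x : ℝ, (fun t => f t x) =
      (Ici x).indicator (fun t : ℝ => (t : ℂ) ^ (s - 1)) := by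
    intro x
    ext t
    by_cases h : x ≤ t <;> simp [hf, h]
  have hsub : ∀ x : ℝ, 0 < x → Ici x ∩ Ioi 0 = Ici x := fun x hx =>
    inter_eq_left.2 fun t ht => lt_of_lt_of_le hx ht
  have hmeas : Measurable (Function.uncurry f) := by
    have h1 : Measurable (fun p : ℝ × ℝ => (p.1 : ℂ) ^ (s - 1)) := by fun_prop
    have h2 : Measurable ({p : ℝ × ℝ | p.2 ≤ p.1}.indicator (1 : ℝ × ℝ → ℂ)) :=
      measurable_one.indicator (measurableSet_le measurable_snd measurable_fst)
    exact h1.mul h2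
  have hF : Integrable (Function.uncurry f) ((volume.restrict (Ioi 0)).prod ρ) := by
    rw [integrable_prod_iff' hmeas.aestronglyMeasurable]
    constructor
    · filter_upwards [hρ] with x hx
      change Integrable (fun t => f t x) _
      rw [hfx x, integrable_indicator_iff measurableSet_Ici, IntegrableOn,
        Measure.restrict_restrict measurableSet_Ici, hsub x hx,
        Measure.restrict_congr_set Ioi_ae_eq_Ici.symm]
      exact integrableOn_Ioi_cpow_of_lt hre hx
    · refine (hint.norm.div_const (-s.re)).congr ?_
      filter_upwards [hρ] with x hx
      change _ = ∫ t in Ioi (0 : ℝ), ‖f t x‖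
      have : (fun t => ‖f t x‖) = (Ici x).indicator (fun t : ℝ => ‖(t : ℂ) ^ (s - 1)‖) := by
        ext t
        rw [congrFun (hfx x) t, norm_indicator_eq_indicator_norm]
      rw [this, setIntegral_indicator measurableSet_Ici, inter_comm, hsub x hx,
        integral_Ici_eq_integral_Ioi, Complex.norm_cpow_eq_rpow_re_of_pos hx,
        setIntegral_congr_fun (g := fun t : ℝ => t ^ (s.re - 1)) measurableSet_Ioi
          (fun t ht => by
            simp only
            rw [Complex.norm_cpow_eq_rpow_re_of_pos (hx.trans ht)]
            simp),
        integral_Ioi_rpow_of_lt (by linarith) hx]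
      rw [sub_add_cancel, neg_div, div_neg]
  have hinner : ∀ t : ℝ, ∫ x, f t x ∂ρ = (t : ℂ) ^ (s - 1) • (cdf ρ t : ℂ) := by
    intro t
    rw [hf]
    simp only
    rw [integral_const_mul, integral_indicator measurableSet_Iic, cdf_eq_real, smul_eq_mul]
    simp
  refine ⟨hF.integral_prod_left.congr (ae_of_all _ hinner), ?_⟩
  rw [mellin]
  simp_rw [← hinner]
  rw [integral_integral_swap hF, ← integral_neg, ← integral_div]
  refine integral_congr_ae ?_
  filter_upwards [hρ] with x hx
  rw [hfx x, setIntegral_indicator measurableSet_Ici, inter_comm, hsub x hx,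
    integral_Ici_eq_integral_Ioi, integral_Ioi_cpow_of_lt hre hx, sub_add_cancel]

theorem integrable_cpow_neg_gammaMeasure_one {a : ℝ} (ha : 0 < a) {s : ℂ} (hs : s.re < a) :
    Integrable (fun x : ℝ => (x : ℂ) ^ (-s)) (gammaMeasure a 1) := by
  have hG : 0 < Real.Gamma a := Real.Gamma_pos_of_pos ha
  rw [gammaMeasure_one_eq_withDensity_Ioi, integrable_withDensity_iff_integrable_smul₀'
    (by fun_prop) (by simp)]
  have h := (Complex.GammaIntegral_convergent (s := a - s) (by simpa using hs)).div_const
    (Complex.Gamma a)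
  refine IntegrableOn.congr_fun h (fun x hx => ?_) measurableSet_Ioi
  have hx : 0 < x := hx
  have : (0 : ℝ) ≤ x ^ (a - 1) * Real.exp (-x) / Real.Gamma a := by positivity
  have hx0 : (x : ℂ) ≠ 0 := Complex.ofReal_ne_zero.2 hx.ne'
  simp only [ENNReal.toReal_ofReal this, Complex.real_smul]
  rw [Complex.Gamma_ofReal, show (a : ℂ) - s - 1 = ((a - 1 : ℝ) : ℂ) + (-s) by push_cast; ring,
    Complex.cpow_add _ _ hx0, ← Complex.ofReal_cpow hx.le]
  push_cast
  ring

theorem integral_cpow_neg_gammaMeasure_one {a : ℝ} (ha : 0 < a) {s : ℂ} (hs : s.re < a) :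
    ∫ x : ℝ, (x : ℂ) ^ (-s) ∂gammaMeasure a 1 = Complex.Gamma (a - s) / Complex.Gamma a := by
  rw [integral_gammaMeasure_one ha, Complex.Gamma_eq_integral (s := a - s) (by simpa using hs),
    Complex.GammaIntegral]
  congr 1
  refine setIntegral_congr_fun measurableSet_Ioi fun x hx => ?_
  have hx0 : (x : ℂ) ≠ 0 := Complex.ofReal_ne_zero.2 (ne_of_gt hx)
  rw [show (a : ℂ) - s - 1 = ((a : ℂ) - 1) + (-s) by ring, Complex.cpow_add _ _ hx0]
  push_cast
  ring

theorem norm_Gamma_le_Gamma_re {s : ℂ} (hs : 0 < s.re) : ‖Complex.Gamma s‖ ≤ Real.Gamma s.re := by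
  rw [Complex.Gamma_eq_integral hs, Complex.GammaIntegral, Real.Gamma_eq_integral hs]
  refine (norm_integral_le_integral_norm _).trans_eq ?_
  refine setIntegral_congr_fun measurableSet_Ioi fun x hx => ?_
  rw [norm_mul, Complex.norm_cpow_eq_rpow_re_of_pos hx, Complex.norm_real,
    Real.norm_of_nonneg (Real.exp_pos _).le]
  simp

/-- Bounding `Γ` on a vertical line by its value on the real axis, after raising the argument of
one of the two factors by one, leaves quadratic decay. -/
theorem norm_Gamma_mul_Gamma_div_le {m n c : ℝ} (hc : 0 < c) (hcm : c < m) (hcn : c < n) (t : ℝ) :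
    ‖Complex.Gamma (m - (c + t * Complex.I)) * Complex.Gamma (n - (c + t * Complex.I)) /
      (c + t * Complex.I)‖ ≤
      Real.Gamma (m - c + 1) * Real.Gamma (n - c) / min 1 (min c (m - c)) ^ 2 *
        (1 + t ^ 2)⁻¹ := by
  -- `e` bounds the real parts of `s` and `m - s` from below, and `e ≤ 1` bounds both moduli from
  -- below by `e * √(1 + t ^ 2)`
  set e := min 1 (min c (m - c)) with he
  have he0 : 0 < e := lt_min one_pos (lt_min hc (sub_pos.2 hcm))
  have hlow : ∀ z : ℂ, e ≤ z.re → z.im ^ 2 = t ^ 2 → e * √(1 + t ^ 2) ≤ ‖z‖ := by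
    intro z hz hzt
    refine (pow_le_pow_iff_left₀ (by positivity) (norm_nonneg z) two_ne_zero).1 ?_
    rw [mul_pow, Real.sq_sqrt (by positivity), Complex.sq_norm, Complex.normSq_apply, ← sq, ← sq,
      hzt]
    have h1 : e ^ 2 ≤ 1 := pow_le_one₀ he0.le (min_le_left _ _)
    have h2 : e ^ 2 ≤ z.re ^ 2 := pow_le_pow_left₀ he0.le hz 2
    nlinarith [mul_le_mul_of_nonneg_right h1 (sq_nonneg t)]
  set s : ℂ := c + t * Complex.I with hs
  have hsre : s.re = c := by simp [hs]
  have hsim : s.im = t := by simp [hs]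
  have h1 : e * √(1 + t ^ 2) ≤ ‖s‖ :=
    hlow s (by rw [hsre]; exact (min_le_right _ _).trans (min_le_left _ _)) (by rw [hsim])
  have h2 : e * √(1 + t ^ 2) ≤ ‖(m : ℂ) - s‖ :=
    hlow _ (by simp [hsre, he]) (by simp [hsim])
  have hpos : 0 < e * √(1 + t ^ 2) := by positivity
  have hms : (m : ℂ) - s ≠ 0 := norm_pos_iff.1 (hpos.trans_le h2)
  have hG1 : ‖Complex.Gamma ((m : ℂ) - s + 1)‖ ≤ Real.Gamma (m - c + 1) := by
    have hr : ((m : ℂ) - s + 1).re = m - c + 1 := by simp [hsre]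
    rw [← hr]
    exact norm_Gamma_le_Gamma_re (by rw [hr]; linarith)
  have hG2 : ‖Complex.Gamma ((n : ℂ) - s)‖ ≤ Real.Gamma (n - c) := by
    have hr : ((n : ℂ) - s).re = n - c := by simp [hsre]
    rw [← hr]
    exact norm_Gamma_le_Gamma_re (by rw [hr]; linarith)
  have hG0 : Complex.Gamma ((m : ℂ) - s) = Complex.Gamma ((m : ℂ) - s + 1) / ((m : ℂ) - s) := by
    rw [Complex.Gamma_add_one _ hms, mul_div_cancel_left₀ _ hms]
  have hsq : e ^ 2 * (1 + t ^ 2) = e * √(1 + t ^ 2) * (e * √(1 + t ^ 2)) := by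
    rw [← sq, mul_pow, Real.sq_sqrt (by positivity)]
  rw [hG0, norm_div, norm_mul, norm_div, div_mul_eq_mul_div, div_div, ← div_eq_mul_inv, div_div,
    hsq]
  gcongr

theorem integrable_Gamma_mul_Gamma_div {m n c : ℝ} (hc : 0 < c) (hcm : c < m) (hcn : c < n) :
    Integrable (fun t : ℝ => Complex.Gamma (m - (c + t * Complex.I)) *
      Complex.Gamma (n - (c + t * Complex.I)) / (c + t * Complex.I)) := by
  have hline : Continuous fun t : ℝ => (c : ℂ) + t * Complex.I := by fun_prop
  have hGam : ∀ b : ℝ, c < b →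
      Continuous fun t : ℝ => Complex.Gamma (b - (c + t * Complex.I)) := by
    intro b hb
    refine continuous_iff_continuousAt.2 fun t => ?_
    refine ContinuousAt.comp (g := Complex.Gamma) ?_ (by fun_prop)
    refine (Complex.differentiableAt_Gamma _ fun k h => ?_).continuousAt
    have h := congrArg Complex.re h
    simp at h
    have : (0 : ℝ) ≤ k := k.cast_nonneg
    linarith
  refine (integrable_inv_one_add_sq.const_mul _).mono'
    (Continuous.aestronglyMeasurable ?_) (ae_of_all _ (norm_Gamma_mul_Gamma_div_le hc hcm hcn))
  refine ((hGam m hcm).mul (hGam n hcn)).div hline fun t h => ?_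
  have h := congrArg Complex.re h
  simp at h
  exact hc.ne' h

/-! ### The law of the channel gain -/

/-- The law of `‖u‖² ‖v‖²` for independent standard complex normal vectors `u`, `v` of dimensions
`m` and `n`: that of a product of independent gamma variables. -/
noncomputable def keyholeGainLaw (m n : ℕ) : Measure ℝ :=
  ((gammaMeasure m 1).prod (gammaMeasure n 1)).map (fun p => p.1 * p.2)

section KeyholeGainLaw

variable {m n : ℕ}

theorem isProbabilityMeasure_keyholeGainLaw (hm : 1 ≤ m) (hn : 1 ≤ n) :
    IsProbabilityMeasure (keyholeGainLaw m n) := by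
  have := isProbabilityMeasure_gammaMeasure (a := m) (by exact_mod_cast hm) one_pos
  have := isProbabilityMeasure_gammaMeasure (a := n) (by exact_mod_cast hn) one_pos
  exact Measure.isProbabilityMeasure_map (by fun_prop)

theorem ae_pos_gammaMeasure_one (a : ℝ) : ∀ᵐ x ∂gammaMeasure a 1, 0 < x := by
  rw [gammaMeasure_one_eq_withDensity_Ioi]
  exact (withDensity_absolutelyContinuous _ _).ae_le (ae_restrict_mem measurableSet_Ioi)

theorem ae_pos_keyholeGainLaw (hm : 1 ≤ m) (hn : 1 ≤ n) : ∀ᵐ x ∂keyholeGainLaw m n, 0 < x := by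
  rw [keyholeGainLaw, map_mul_gammaMeasure_prod hm hn]
  exact (withDensity_absolutelyContinuous _ _).ae_le (ae_restrict_mem measurableSet_Ioi)

theorem nullSingletonClass_keyholeGainLaw (hm : 1 ≤ m) (hn : 1 ≤ n) :
    NullSingletonClass (keyholeGainLaw m n) := by
  rw [keyholeGainLaw, map_mul_gammaMeasure_prod hm hn]
  infer_instance

/-- Mellin inversion needs continuity at the point; the law has a density, hence no atoms. -/
theorem continuous_cdf_keyholeGainLaw (hm : 1 ≤ m) (hn : 1 ≤ n) :
    Continuous (cdf (keyholeGainLaw m n)) := by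
  have := isProbabilityMeasure_keyholeGainLaw hm hn
  have := nullSingletonClass_keyholeGainLaw hm hn
  refine continuous_iff_continuousAt.2 fun x => ?_
  have h := StieltjesFunction.measure_singleton (cdf (keyholeGainLaw m n)) x
  rw [measure_cdf, measure_singleton, eq_comm, ENNReal.ofReal_eq_zero, sub_nonpos] at h
  rw [(monotone_cdf _).continuousAt_iff_leftLim_eq_rightLim, StieltjesFunction.rightLim_eq]
  exact le_antisymm ((monotone_cdf _).leftLim_le le_rfl) h

theorem integrable_and_integral_cpow_neg_keyholeGainLaw (hm : 1 ≤ m) (hn : 1 ≤ n) {s : ℂ}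
    (hsm : s.re < m) (hsn : s.re < n) :
    Integrable (fun x : ℝ => (x : ℂ) ^ (-s)) (keyholeGainLaw m n) ∧
      ∫ x : ℝ, (x : ℂ) ^ (-s) ∂keyholeGainLaw m n =
        Complex.Gamma (m - s) * Complex.Gamma (n - s) /
          (Complex.Gamma m * Complex.Gamma n) := by
  have hm0 : (0 : ℝ) < m := by exact_mod_cast hm
  have hn0 : (0 : ℝ) < n := by exact_mod_cast hn
  have := isProbabilityMeasure_gammaMeasure hm0 one_pos
  have := isProbabilityMeasure_gammaMeasure hn0 one_pos
  have hae : (fun p : ℝ × ℝ => (p.1 : ℂ) ^ (-s) * (p.2 : ℂ) ^ (-s))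
      =ᵐ[(gammaMeasure m 1).prod (gammaMeasure n 1)] fun p => ((p.1 * p.2 : ℝ) : ℂ) ^ (-s) := by
    have h1 := Measure.quasiMeasurePreserving_fst (μ := gammaMeasure m 1)
      (ν := gammaMeasure n 1) |>.ae (ae_pos_gammaMeasure_one m)
    have h2 := Measure.quasiMeasurePreserving_snd (μ := gammaMeasure m 1)
      (ν := gammaMeasure n 1) |>.ae (ae_pos_gammaMeasure_one n)
    filter_upwards [h1, h2] with p hp1 hp2
    rw [Complex.ofReal_mul, Complex.mul_cpow_ofReal_nonneg hp1.le hp2.le]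
  have hcm : Measurable fun x : ℝ => (x : ℂ) ^ (-s) := by fun_prop
  constructor
  · rw [keyholeGainLaw, integrable_map_measure hcm.aestronglyMeasurable (by fun_prop)]
    exact ((integrable_cpow_neg_gammaMeasure_one hm0 hsm).mul_prod
      (integrable_cpow_neg_gammaMeasure_one hn0 hsn)).congr hae
  · rw [keyholeGainLaw, integral_map (by fun_prop) hcm.aestronglyMeasurable,
      ← integral_congr_ae hae, integral_prod_mul (fun x : ℝ => (x : ℂ) ^ (-s))
        (fun x : ℝ => (x : ℂ) ^ (-s)), integral_cpow_neg_gammaMeasure_one hm0 hsm,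
      integral_cpow_neg_gammaMeasure_one hn0 hsn, div_mul_div_comm]
    simp

/-- The Mellin transform of the distribution function of the channel gain: the Mellin-Barnes
integrand up to the factor `Γ(m) Γ(n)`, because `Γ(s) / Γ(1 + s) = 1 / s`. -/
theorem mellin_cdf_keyholeGainLaw (hm : 1 ≤ m) (hn : 1 ≤ n) {s : ℂ} (hs : 0 < s.re)
    (hsm : s.re < m) (hsn : s.re < n) :
    MellinConvergent (fun t => (cdf (keyholeGainLaw m n) t : ℂ)) (-s) ∧
      mellin (fun t => (cdf (keyholeGainLaw m n) t : ℂ)) (-s) =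
        Complex.Gamma (m - s) * Complex.Gamma (n - s) / s /
          (Complex.Gamma m * Complex.Gamma n) := by
  have := isProbabilityMeasure_keyholeGainLaw hm hn
  obtain ⟨h1, h2⟩ := integrable_and_integral_cpow_neg_keyholeGainLaw hm hn hsm hsn
  obtain ⟨h3, h4⟩ := mellin_cdf (ae_pos_keyholeGainLaw hm hn) (by simpa using hs) h1
  refine ⟨h3, ?_⟩
  rw [h4, h2, neg_div_neg_eq, div_right_comm]

end KeyholeGainLaw

/-! ### The Meijer G-function as a distribution function -/

section MeijerG

variable {m n : ℕ}

theorem Gamma_natCast_mul_Gamma_natCast_ne_zero (hm : 1 ≤ m) (hn : 1 ≤ n) :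
    Complex.Gamma m * Complex.Gamma n ≠ 0 :=
  mul_ne_zero (Complex.Gamma_ne_zero_of_re_pos (by simpa using Nat.lt_of_succ_le hm))
    (Complex.Gamma_ne_zero_of_re_pos (by simpa using Nat.lt_of_succ_le hn))

theorem separatesPoles_iff {c : ℝ} :
    SeparatesPoles 2 1 ![(1 : ℂ)] ![(m : ℂ), (n : ℂ), 0] c ↔ 0 < c ∧ c < m ∧ c < n := by
  simp [SeparatesPoles, Fin.forall_fin_succ, and_comm, and_assoc]

theorem exists_separatesPoles (hm : 1 ≤ m) (hn : 1 ≤ n) :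
    ∃ c : ℝ, SeparatesPoles 2 1 ![(1 : ℂ)] ![(m : ℂ), (n : ℂ), 0] c := by
  refine ⟨1 / 2, separatesPoles_iff.2 ⟨by norm_num, ?_, ?_⟩⟩ <;>
  · refine lt_of_lt_of_le (by norm_num : (1 / 2 : ℝ) < 1) ?_
    exact_mod_cast ‹_›

theorem meijerGIntegrand_eq {s : ℂ} (hs : 0 < s.re) (z : ℂ) :
    meijerGIntegrand 2 1 ![(1 : ℂ)] ![(m : ℂ), (n : ℂ), 0] z s =
      Complex.Gamma (m - s) * Complex.Gamma (n - s) / s * z ^ s := by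
  have hs0 : s ≠ 0 := fun h => by simp [h] at hs
  have hG : Complex.Gamma s ≠ 0 := Complex.Gamma_ne_zero_of_re_pos hs
  have h1 : Complex.Gamma (1 + s) = s * Complex.Gamma s := by
    rw [add_comm, Complex.Gamma_add_one s hs0]
  simp [meijerGIntegrand, Finset.prod_filter, Fin.prod_univ_three, h1]
  left
  field_simp

theorem integrable_meijerGIntegrand {c : ℝ} (hc : 0 < c) (hcm : c < m) (hcn : c < n) {x : ℝ}
    (hx : 0 < x) :
    Integrable (fun t : ℝ => meijerGIntegrand 2 1 ![(1 : ℂ)] ![(m : ℂ), (n : ℂ), 0] (x : ℂ)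
      (c + t * Complex.I)) := by
  have hx0 : (x : ℂ) ≠ 0 := Complex.ofReal_ne_zero.2 hx.ne'
  simp_rw [fun t : ℝ => meijerGIntegrand_eq (m := m) (n := n) (s := c + t * Complex.I)
    (by simpa using hc) x]
  -- on the line, `x ^ s` has constant modulus `x ^ c`
  refine (integrable_Gamma_mul_Gamma_div hc hcm hcn).mul_bdd (c := x ^ c) ?_
    (ae_of_all _ fun t => ?_)
  · exact (Continuous.const_cpow (by fun_prop) (Or.inl hx0)).aestronglyMeasurable
  · rw [Complex.norm_cpow_eq_rpow_re_of_pos hx]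
    simp

/-- Mellin inversion: along every separating line the Mellin-Barnes integral is, up to the factor
`Γ(m) Γ(n)`, the distribution function of the channel gain. -/
theorem meijerGLine_eq_cdf (hm : 1 ≤ m) (hn : 1 ≤ n) {c : ℝ} (hc : 0 < c) (hcm : c < m)
    (hcn : c < n) {x : ℝ} (hx : 0 < x) :
    meijerGLine 2 1 ![(1 : ℂ)] ![(m : ℂ), (n : ℂ), 0] c x =
      Complex.Gamma m * Complex.Gamma n * cdf (keyholeGainLaw m n) x := by
  set F : ℝ → ℂ := fun t => (cdf (keyholeGainLaw m n) t : ℂ) with hF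
  have hG : Complex.Gamma m * Complex.Gamma n ≠ 0 :=
    Gamma_natCast_mul_Gamma_natCast_ne_zero hm hn
  have hmel : ∀ t : ℝ, mellin F (-(c + t * Complex.I)) =
      Complex.Gamma (m - (c + t * Complex.I)) * Complex.Gamma (n - (c + t * Complex.I)) /
        (c + t * Complex.I) / (Complex.Gamma m * Complex.Gamma n) := fun t =>
    (mellin_cdf_keyholeGainLaw hm hn (by simpa using hc) (by simpa using hcm)
      (by simpa using hcn)).2
  have hneg : ∀ t : ℝ, ((-c : ℝ) : ℂ) + ((-t : ℝ) : ℂ) * Complex.I = -(c + t * Complex.I) := by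
    intro t
    push_cast
    ring
  have hconv : MellinConvergent F ((-c : ℝ) : ℂ) := by
    rw [Complex.ofReal_neg]
    exact (mellin_cdf_keyholeGainLaw hm hn (s := c) (by simpa using hc) (by simpa using hcm)
      (by simpa using hcn)).1
  have hvert : Complex.VerticalIntegrable (mellin F) (-c) := by
    have h := ((integrable_Gamma_mul_Gamma_div hc hcm hcn).div_const
      (Complex.Gamma m * Complex.Gamma n)).comp_neg
    refine h.congr (ae_of_all _ fun t => ?_)
    have ht := hneg (-t)
    rw [neg_neg] at ht
    simp only
    rw [ht, hmel]
    rfl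
  have hinv := mellinInv_mellin_eq (-c) F hx hconv hvert
    (Complex.continuous_ofReal.comp (continuous_cdf_keyholeGainLaw hm hn)).continuousAt
  change _ = Complex.Gamma m * Complex.Gamma n * F x
  -- `mellinInv` runs along `Re s = -c`, and `s ↦ -s` carries that line to `Re s = c`
  rw [← hinv, mellinInv, ← integral_neg_eq_self, meijerGLine]
  simp_rw [hneg, hmel, neg_neg, fun t : ℝ => meijerGIntegrand_eq (m := m) (n := n)
    (s := c + t * Complex.I) (by simpa using hc) x]
  rw [mul_smul_comm, Complex.real_smul]
  push_cast
  congr 1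
  rw [← integral_const_mul]
  refine integral_congr_ae (ae_of_all _ fun t => ?_)
  obtain ⟨hGm, hGn⟩ := mul_ne_zero_iff.1 hG
  simp only [smul_eq_mul]
  field_simp

theorem meijerG_eq_cdf (hm : 1 ≤ m) (hn : 1 ≤ n) {x : ℝ} (hx : 0 < x) :
    meijerG 2 1 ![(1 : ℂ)] ![(m : ℂ), (n : ℂ), 0] x =
      Complex.Gamma m * Complex.Gamma n * cdf (keyholeGainLaw m n) x := by
  have hex := exists_separatesPoles hm hn
  rw [meijerG, dif_pos hex]
  obtain ⟨hc, hcm, hcn⟩ := separatesPoles_iff.1 hex.choose_spec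
  exact meijerGLine_eq_cdf hm hn hc hcm hcn hx

end MeijerG

/-! ### The outage event -/

section Outage

variable {NR NT : ℕ}

theorem sum_sq_norm_keyholeChannel (u : EuclideanSpace ℂ (Fin NR))
    (v : EuclideanSpace ℂ (Fin NT)) :
    ∑ i, ∑ j, ‖keyholeChannel u v i j‖ ^ 2 = ‖u‖ ^ 2 * ‖v‖ ^ 2 := by
  rw [EuclideanSpace.norm_sq_eq, EuclideanSpace.norm_sq_eq, Finset.sum_mul_sum]
  simp [keyholeChannel, mul_pow]

/-- The matrix `H Hᴴ` of the keyhole channel has rank one, so the determinant is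
`1 + (γ / N_T) ‖u‖² ‖v‖²`. -/
theorem roundMutualInfo_keyholeChannel (γ : ℝ) (u : EuclideanSpace ℂ (Fin NR))
    (v : EuclideanSpace ℂ (Fin NT)) :
    roundMutualInfo γ (keyholeChannel u v) = Real.logb 2 (1 + γ / NT * (‖u‖ ^ 2 * ‖v‖ ^ 2)) := by
  have h : ((γ / NT : ℝ) : ℂ) • (keyholeChannel u v * (keyholeChannel u v)ᴴ) =
      Matrix.replicateCol Unit (fun i => ((γ / NT * ‖v‖ ^ 2 : ℝ) : ℂ) * u i) *
        Matrix.replicateRow Unit (fun i => star (u i)) := by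
    ext i k
    rw [EuclideanSpace.norm_sq_eq]
    simp only [Matrix.smul_apply, Matrix.mul_apply, Matrix.conjTranspose_apply, keyholeChannel,
      Matrix.of_apply, Matrix.replicateCol_apply, Matrix.replicateRow_apply, Finset.univ_unique,
      Finset.sum_singleton, smul_eq_mul]
    push_cast
    rw [Finset.mul_sum, Finset.mul_sum, Finset.sum_mul, Finset.sum_mul]
    refine Finset.sum_congr rfl fun j _ => ?_
    rw [← Complex.mul_conj']
    simp
    ring
  rw [roundMutualInfo, h, Matrix.det_one_add_replicateCol_mul_replicateRow]
  congr 1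
  have h2 : (fun i => star (u i)) ⬝ᵥ (fun i => ((γ / NT * ‖v‖ ^ 2 : ℝ) : ℂ) * u i) =
      ((γ / NT * (‖u‖ ^ 2 * ‖v‖ ^ 2) : ℝ) : ℂ) := by
    rw [EuclideanSpace.norm_sq_eq u, dotProduct]
    push_cast
    rw [Finset.sum_mul, Finset.mul_sum]
    refine Finset.sum_congr rfl fun j _ => ?_
    rw [← Complex.conj_mul']
    simp
    ring
  rw [h2, Complex.add_re, Complex.one_re, Complex.ofReal_re]

theorem roundMutualInfo_keyholeChannel_lt_iff (hNT : 1 ≤ NT) {γ : ℝ} (hγ : 0 < γ) (R : ℝ)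
    (u : EuclideanSpace ℂ (Fin NR)) (v : EuclideanSpace ℂ (Fin NT)) :
    roundMutualInfo γ (keyholeChannel u v) < R ↔
      ‖u‖ ^ 2 * ‖v‖ ^ 2 < NT / γ * ((2 : ℝ) ^ R - 1) := by
  have hNT0 : (0 : ℝ) < NT := by exact_mod_cast hNT
  rw [roundMutualInfo_keyholeChannel, Real.logb_lt_iff_lt_rpow one_lt_two (by positivity),
    ← lt_sub_iff_add_lt', ← lt_div_iff₀' (by positivity)]
  have h : ((2 : ℝ) ^ R - 1) / (γ / NT) = NT / γ * ((2 : ℝ) ^ R - 1) := by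
    field_simp
  rw [h]

theorem hasLaw_keyholeGain {Ω : Type*} [MeasurableSpace Ω] {μ : Measure Ω}
    [IsProbabilityMeasure μ] (hNT : 1 ≤ NT) (hNR : 1 ≤ NR) {u : Ω → EuclideanSpace ℂ (Fin NR)}
    {v : Ω → EuclideanSpace ℂ (Fin NT)} (hu : HasLaw u (stdComplexNormalVec NR) μ)
    (hv : HasLaw v (stdComplexNormalVec NT) μ) (huv : IndepFun u v μ) :
    HasLaw (fun ω => ‖u ω‖ ^ 2 * ‖v ω‖ ^ 2) (keyholeGainLaw NR NT) μ := by
  have := isProbabilityMeasure_gammaMeasure (a := NR) (by exact_mod_cast hNR) one_pos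
  have := isProbabilityMeasure_gammaMeasure (a := NT) (by exact_mod_cast hNT) one_pos
  have h1 := (hasLaw_sq_norm_stdComplexNormalVec hNR).fun_comp hu
  have h2 := (hasLaw_sq_norm_stdComplexNormalVec hNT).fun_comp hv
  have h12 : IndepFun (fun ω => ‖u ω‖ ^ 2) (fun ω => ‖v ω‖ ^ 2) μ :=
    huv.comp (φ := fun z => ‖z‖ ^ 2) (ψ := fun z => ‖z‖ ^ 2) (by fun_prop) (by fun_prop)
  have h := (indepFun_iff_hasLaw_prodMk_prod h1 h2).1 h12
  exact HasLaw.fun_comp (Y := fun p : ℝ × ℝ => p.1 * p.2) ⟨by fun_prop, rfl⟩ h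

end Outage

theorem mainTheorem6 {Ω : Type*} [MeasurableSpace Ω] (μ : Measure Ω) [IsProbabilityMeasure μ]
    {K NT NR : ℕ} [NeZero K] (hNT : 1 ≤ NT) (hNR : 1 ≤ NR)
    (γ : Fin K → ℝ) (hγ : ∀ k, 0 < γ k) (R : ℝ) (hR : 0 < R)
    (u : Fin K → Ω → EuclideanSpace ℂ (Fin NR)) (v : Fin K → Ω → EuclideanSpace ℂ (Fin NT))
    (hu : ∀ k, HasLaw (u k) (stdComplexNormalVec NR) μ)
    (hv : ∀ k, HasLaw (v k) (stdComplexNormalVec NT) μ)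
    (huv : ∀ k, IndepFun (u k) (v k) μ)
    (hH : iIndepFun (fun k ω => fun i j => keyholeChannel (u k ω) (v k ω) i j) μ) :
    -- the density of the channel gain of each round
    (∀ k, HasLaw (fun ω => ‖u k ω‖ ^ 2 * ‖v k ω‖ ^ 2)
      ((volume.restrict (Ioi 0)).withDensity
        (fun x => ENNReal.ofReal (keyholeGainDensity NT NR x))) μ) ∧
    -- the Meijer G-function below is a convergent integral, the same for every separating line
    (∃ c : ℝ, SeparatesPoles 2 1 ![(1 : ℂ)] ![(NT : ℂ), (NR : ℂ), 0] c) ∧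
    (∀ c : ℝ, SeparatesPoles 2 1 ![(1 : ℂ)] ![(NT : ℂ), (NR : ℂ), 0] c → ∀ x : ℝ, 0 < x →
      Integrable (fun t : ℝ => meijerGIntegrand 2 1 ![(1 : ℂ)] ![(NT : ℂ), (NR : ℂ), 0] (x : ℂ)
        (c + t * Complex.I)) ∧
      meijerGLine 2 1 ![(1 : ℂ)] ![(NT : ℂ), (NR : ℂ), 0] c (x : ℂ) =
        meijerG 2 1 ![(1 : ℂ)] ![(NT : ℂ), (NR : ℂ), 0] (x : ℂ)) ∧
    -- the closed form of the outage probability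
    ((typeIOutage μ γ (fun k ω => keyholeChannel (u k ω) (v k ω)) R : ℝ) : ℂ) =
      (∏ k, meijerG 2 1 ![(1 : ℂ)] ![(NT : ℂ), (NR : ℂ), 0]
        ((NT / γ k * ((2 : ℝ) ^ R - 1) : ℝ) : ℂ)) /
      (Complex.Gamma NT * Complex.Gamma NR) ^ K := by
  have hlaw := fun k => hasLaw_keyholeGain hNT hNR (hu k) (hv k) (huv k)
  have hprob := isProbabilityMeasure_keyholeGainLaw hNR hNT
  have := nullSingletonClass_keyholeGainLaw hNR hNT
  have hcomm : keyholeGainLaw NT NR = keyholeGainLaw NR NT := by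
    simp_rw [keyholeGainLaw, map_mul_gammaMeasure_prod hNT hNR, map_mul_gammaMeasure_prod hNR hNT,
      keyholeGainDensity_comm NT NR]
  refine ⟨fun k => ?_, ?_, fun c hc x hx => ?_, ?_⟩
  · rw [← map_mul_gammaMeasure_prod hNR hNT]
    exact hlaw k
  · exact exists_separatesPoles hNT hNR
  · obtain ⟨hc0, hcT, hcR⟩ := separatesPoles_iff.1 hc
    exact ⟨integrable_meijerGIntegrand hc0 hcT hcR hx,
      (meijerGLine_eq_cdf hNT hNR hc0 hcT hcR hx).trans (meijerG_eq_cdf hNT hNR hx).symm⟩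
  · set r : Fin K → ℝ := fun k => NT / γ k * ((2 : ℝ) ^ R - 1) with hr
    have hr0 : ∀ k, 0 < r k := fun k =>
      mul_pos (div_pos (by exact_mod_cast hNT) (hγ k))
        (sub_pos.2 (Real.one_lt_rpow one_lt_two hR))
    -- the outage event of a round depends on the channel matrix through its Frobenius norm
    set A : Fin K → Set (Fin NR → Fin NT → ℂ) :=
      fun k => {M | ∑ i, ∑ j, ‖M i j‖ ^ 2 < r k} with hA
    have hAm : ∀ k, MeasurableSet (A k) := fun k =>
      measurableSet_lt (by fun_prop) measurable_const
    have hpre : ∀ k, (fun ω => fun i j => keyholeChannel (u k ω) (v k ω) i j) ⁻¹' A k =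
        {ω | ‖u k ω‖ ^ 2 * ‖v k ω‖ ^ 2 < r k} := by
      intro k
      ext ω
      simp only [hA, mem_preimage, mem_ofPred_eq, sum_sq_norm_keyholeChannel]
    have hevent : {ω | typeIMutualInfo γ (fun k => keyholeChannel (u k ω) (v k ω)) < R} =
        ⋂ k ∈ Finset.univ, (fun ω => fun i j => keyholeChannel (u k ω) (v k ω) i j) ⁻¹' A k := by
      simp_rw [hpre]
      ext ω
      simp [typeIMutualInfo, Finset.sup'_lt_iff, roundMutualInfo_keyholeChannel_lt_iff hNT (hγ _),
        hr]
    have hround : ∀ k, μ.real {ω | ‖u k ω‖ ^ 2 * ‖v k ω‖ ^ 2 < r k} =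
        cdf (keyholeGainLaw NR NT) (r k) := by
      intro k
      rw [(hlaw k).measureReal_eq (p := fun x => x < r k) measurableSet_Iio, cdf_eq_real]
      -- the law has no atoms, so the strict inequality may be replaced by a weak one
      exact congrArg ENNReal.toReal (measure_congr Iio_ae_eq_Iic)
    have hout : typeIOutage μ γ (fun k ω => keyholeChannel (u k ω) (v k ω)) R =
        ∏ k, cdf (keyholeGainLaw NR NT) (r k) := by
      rw [typeIOutage, hevent, measureReal_def,
        hH.measure_inter_preimage_eq_mul Finset.univ fun k _ => hAm k, ENNReal.toReal_prod]
      refine Finset.prod_congr rfl fun k _ => ?_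
      rw [hpre k, ← hround k, measureReal_def]
    have hG : Complex.Gamma NT * Complex.Gamma NR ≠ 0 :=
      Gamma_natCast_mul_Gamma_natCast_ne_zero hNT hNR
    rw [hout, Finset.prod_congr rfl fun k _ => meijerG_eq_cdf hNT hNR (hr0 k), hcomm,
      Finset.prod_mul_distrib, Finset.prod_const, Finset.card_univ, Fintype.card_fin,
      mul_div_cancel_left₀ _ (pow_ne_zero _ hG)]
    push_cast
    rfl
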